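/- Let $n\ge 1$ and $0\le j\le n$ be integers, and let $\omega_k$ denote the volume of the unit ball of $\mathbb{R}^k$ ($\omega_0=1$). Let $G_{n,j}$ be the Grassmann manifold of $j$-dimensional linear subspaces of $\mathbb{R}^n$, and let $\mu_j$ be its normalized Haar measure, that is, its rotation invariant Borel probability measure. For nonempty compact convex sets $K_1,\dots,K_j\subset\mathbb{R}^n$ (in particular, for convex bodies with interior points, or with the origin in their interiors) and $\xi\in G_{n,j}$, let $\mathrm{vol}_j((K_1,\dots,K_j)|\xi)$ denote the mixed volume, in the $j$-dimensional Euclidean space $\xi$, of the orthogonal projections $K_1|\xi,\dots,K_j|\xi$; here the mixed volume of $j$ convex bodies $L_1,\dots,L_j$ in a $j$-dimensional Euclidean space is $$V(L_1,\dots,L_j)=\frac1{j!}\sum_{S\subseteq\{1,\dots,j\}}(-1)^{j-|S|}\,\mathrm{vol}_j\Big(\sum_{i\in S}L_i\Big),$$ with Minkowski sums, the empty sum being $\{0\}$. The mixed affine quermassintegral of $K_1,\dots,K_j$ is $$\Phi_{n-j}(K_1,\dots,K_j)=\omega_n\left[\int_{G_{n,j}}\left(\frac{\mathrm{vol}_j((K_1,\dots,K_j)|\xi)}{\omega_j}\right)^{-n}d\mu_j(\xi)\right]^{-1/n},$$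 where $0^{-n}=\infty$ and $\infty^{-1/n}=0$. Then for all nonempty compact convex sets $K_1,\dots,K_j\subset\mathbb{R}^n$ and every $g\in \mathrm{SL}(n)$ (the real $n\times n$ matrices of determinant $1$), $$\Phi_{n-j}(gK_1,\dots,gK_j)=\Phi_{n-j}(K_1,\dots,K_j).$$ -/

import Mathlib

open MeasureTheory

noncomputable section

/-- The image of a convex body (nonempty compact convex set) under a continuous linear map. -/
def ConvexBody.mapCLM {V W : Type*} [NormedAddCommGroup V] [NormedSpace ℝ V]
    [NormedAddCommGroup W] [NormedSpace ℝ W] (f : V →L[ℝ] W) (K : ConvexBody V) :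
    ConvexBody W where
  carrier := f '' (K : Set V)
  convex' := K.convex.linear_image (f : V →ₗ[ℝ] W)
  isCompact' := K.isCompact.image f.continuous
  nonempty' := K.nonempty.image f

/-- The mixed volume of `j` convex bodies in a Euclidean space `E` (of dimension `j`), by
polarization of the volume:
`V(K₁, …, K_j) = (1 / j!) ∑_{S ⊆ {1, …, j}} (-1) ^ (j - |S|) vol (∑_{i ∈ S} K_i)`,
with Minkowski sums of bodies; the empty sum is the body `{0}`. -/
def mixedVolume {E : Type*} [NormedAddCommGroup E] [InnerProductSpace ℝ E]
    [FiniteDimensional ℝ E] [MeasurableSpace E] [BorelSpace E] {j : ℕ}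
    (K : Fin j → ConvexBody E) : ℝ :=
  (1 / (j.factorial : ℝ)) *
    ∑ S : Finset (Fin j), (-1 : ℝ) ^ (j - S.card) *
      (volume : Measure E).real ((∑ i ∈ S, K i : ConvexBody E) : Set E)

/-- The volume `ω_j` of the Euclidean unit ball of `ℝ^j`. -/
def unitBallVolume (j : ℕ) : ENNReal :=
  volume (Metric.closedBall (0 : EuclideanSpace ℝ (Fin j)) 1)

/-- The Grassmann manifold `G_{n,j}` of `j`-dimensional linear subspaces of `ℝ^n`. -/
structure RealGrassmannian (n j : ℕ) where
  /-- the underlying subspace -/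
  toSubmodule : Submodule ℝ (EuclideanSpace ℝ (Fin n))
  finrank_eq : Module.finrank ℝ toSubmodule = j

namespace RealGrassmannian

/-- The usual topology of `G_{n,j}`: a subspace is identified with the orthogonal projection
onto it, and operators carry the operator norm. -/
instance (n j : ℕ) : TopologicalSpace (RealGrassmannian n j) :=
  TopologicalSpace.induced
    (fun ξ : RealGrassmannian n j => ξ.1.starProjection) inferInstance

instance (n j : ℕ) : MeasurableSpace (RealGrassmannian n j) := borel _

instance (n j : ℕ) : BorelSpace (RealGrassmannian n j) := ⟨rfl⟩

/-- The coordinate subspace spanned by the first `j` standard basis vectors of `ℝ^n`. -/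
def coordinate {n j : ℕ} (hj : j ≤ n) : RealGrassmannian n j :=
  ⟨Submodule.span ℝ (Set.range fun i : Fin j =>
      EuclideanSpace.basisFun (Fin n) ℝ (Fin.castLE hj i)), by
    have h := (EuclideanSpace.basisFun (Fin n) ℝ).orthonormal.linearIndependent.comp
      (Fin.castLE hj) (Fin.castLE_injective hj)
    exact (finrank_span_eq_card h).trans (Fintype.card_fin j)⟩

end RealGrassmannian

instance (n : ℕ) : MeasurableSpace (Matrix.orthogonalGroup (Fin n) ℝ) := borel _

instance (n : ℕ) : BorelSpace (Matrix.orthogonalGroup (Fin n) ℝ) := ⟨rfl⟩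

instance (n : ℕ) : CompactSpace (Matrix.orthogonalGroup (Fin n) ℝ) := by
  refine (isCompact_iff_compactSpace
    (s := (Matrix.orthogonalGroup (Fin n) ℝ : Set (Matrix (Fin n) (Fin n) ℝ)))).mp ?_
  have hc : IsClosed (Matrix.orthogonalGroup (Fin n) ℝ : Set (Matrix (Fin n) (Fin n) ℝ)) := by
    have : (Matrix.orthogonalGroup (Fin n) ℝ : Set (Matrix (Fin n) (Fin n) ℝ)) =
        {A | A * star A = 1} := by
      ext A
      exact Matrix.mem_orthogonalGroup_iff (Fin n) ℝ
    rw [this]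
    exact isClosed_eq (by fun_prop) continuous_const
  have hK : IsCompact (Set.univ.pi fun _ => Set.univ.pi fun _ => Metric.closedBall 0 1 :
      Set (Fin n → Fin n → ℝ)) :=
    isCompact_univ_pi fun _ => isCompact_univ_pi fun _ => isCompact_closedBall _ _
  refine IsCompact.of_isClosed_subset (X := Fin n → Fin n → ℝ) hK hc ?_
  intro A hA i _ k _
  simpa using entry_norm_bound_of_unitary (𝕜 := ℝ) hA i k

/-- The normalized Haar measure on the orthogonal group `O(n)`. -/
def orthogonalHaar (n : ℕ) : Measure (Matrix.orthogonalGroup (Fin n) ℝ) :=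
  Measure.haarMeasure ⊤

/-- The linear isometry of `ℝ^n` given by an orthogonal matrix. -/
def orthogonalIsometry {n : ℕ} (U : Matrix.orthogonalGroup (Fin n) ℝ) :
    EuclideanSpace ℝ (Fin n) ≃ₗᵢ[ℝ] EuclideanSpace ℝ (Fin n) :=
  Unitary.linearIsometryEquiv ⟨Matrix.toEuclideanCLM (n := Fin n) (𝕜 := ℝ) U.1,
    Unitary.map_mem _ U.2⟩

namespace RealGrassmannian

/-- The image `U ξ` of a subspace `ξ` under an orthogonal matrix `U`. -/
def rotate {n j : ℕ} (U : Matrix.orthogonalGroup (Fin n) ℝ) (ξ : RealGrassmannian n j) :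
    RealGrassmannian n j :=
  ⟨ξ.1.map ((orthogonalIsometry U).toLinearEquiv :
      EuclideanSpace ℝ (Fin n) →ₗ[ℝ] EuclideanSpace ℝ (Fin n)), by
    rw [LinearEquiv.finrank_map_eq]; exact ξ.2⟩

/-- The normalized Haar measure `μ_j` on `G_{n,j}`, that is, the rotation invariant Borel
probability measure: the distribution of `U ξ₀` for a fixed `j`-dimensional subspace `ξ₀` and a
Haar distributed random `U` in `O(n)`. -/
def haar {n j : ℕ} (hj : j ≤ n) : Measure (RealGrassmannian n j) :=
  (orthogonalHaar n).map fun U => rotate U (coordinate hj)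

theorem continuous_rotate {n j : ℕ} (ξ : RealGrassmannian n j) :
    Continuous fun U : Matrix.orthogonalGroup (Fin n) ℝ => rotate U ξ := by
  refine continuous_induced_rng.mpr ?_
  let T := Matrix.toEuclideanCLM (n := Fin n) (𝕜 := ℝ)
  have hT : Continuous T := T.toAlgEquiv.toLinearMap.continuous_of_finiteDimensional
  have h : ((fun η : RealGrassmannian n j => η.1.starProjection) ∘
      fun U : Matrix.orthogonalGroup (Fin n) ℝ => rotate U ξ) =
      fun U => T U.1 * ξ.1.starProjection * T (star U.1) := by
    funext U
    refine ContinuousLinearMap.ext fun x => ?_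
    refine (Submodule.starProjection_map_apply (orthogonalIsometry U) ξ.1 x).trans ?_
    rw [map_star]
    rfl
  rw [h]
  have h1 : Continuous fun U : Matrix.orthogonalGroup (Fin n) ℝ => T U.1 :=
    hT.comp continuous_subtype_val
  have h2 : Continuous fun U : Matrix.orthogonalGroup (Fin n) ℝ => T (star U.1) :=
    hT.comp continuous_subtype_val.star
  exact (h1.mul continuous_const).mul h2

instance {n j : ℕ} (hj : j ≤ n) : IsProbabilityMeasure (haar hj) := by
  have : IsProbabilityMeasure (orthogonalHaar n) := ⟨by
    simpa [orthogonalHaar] using Measure.haarMeasure_self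
      (K₀ := (⊤ : TopologicalSpace.PositiveCompacts (Matrix.orthogonalGroup (Fin n) ℝ)))⟩
  exact Measure.isProbabilityMeasure_map (continuous_rotate _).measurable.aemeasurable

end RealGrassmannian

/-- `vol_j ((K₁, …, K_j) | ξ)`: the mixed volume, in the `j`-dimensional Euclidean space `ξ`, of
the orthogonal projections of `K₁, …, K_j` onto `ξ`. -/
def mixedProjectionVolume {n j : ℕ} (K : Fin j → ConvexBody (EuclideanSpace ℝ (Fin n)))
    (ξ : RealGrassmannian n j) : ℝ :=
  mixedVolume fun i => (K i).mapCLM ξ.1.orthogonalProjectionOnto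

/-- The mixed affine quermassintegral
`Φ_{n-j}(K₁, …, K_j) = ω_n [∫_{G_{n,j}} (vol_j((K₁, …, K_j) | ξ) / ω_j) ^ (-n) dμ_j(ξ)] ^ (-1/n)`.
It is computed in `[0, ∞]`, so that a subspace on which the mixed volume vanishes contributes the
value `0 ^ (-n) = ∞` to the integrand, and `∞ ^ (-1/n) = 0`. -/
def mixedAffineQuermassintegral {n j : ℕ} (hj : j ≤ n)
    (K : Fin j → ConvexBody (EuclideanSpace ℝ (Fin n))) : ENNReal :=
  unitBallVolume n *
    (∫⁻ ξ, (ENNReal.ofReal (mixedProjectionVolume K ξ) / unitBallVolume j) ^ (-(n : ℝ))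
      ∂(RealGrassmannian.haar hj)) ^ (-(1 / (n : ℝ)))

/-- The image `g K` of a convex body of `ℝ^n` under `g ∈ SL(n)`. -/
def ConvexBody.slImage {n : ℕ} (g : Matrix.SpecialLinearGroup (Fin n) ℝ)
    (K : ConvexBody (EuclideanSpace ℝ (Fin n))) : ConvexBody (EuclideanSpace ℝ (Fin n)) :=
  K.mapCLM (Matrix.toEuclideanCLM (n := Fin n) (𝕜 := ℝ) g.1)

end

/-!
Let `X` be an `n × j` matrix and let `v(X)` be the mixed volume in `ℝ^j` of the images of the
bodies under `Xᵀ`; if the columns of `X` are an orthonormal basis of `ξ`, this is the mixed volume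
of the projections to `ξ`. Replacing the bodies `K_i` by `A K_i` replaces `v(X)` by `v(Aᵀ X)`, and
`v(X T) = |det T| v(X)`, so that `G = (v / ω_j) ^ (-n)` is homogeneous of degree `-n` under the
right action of `GL(j)`. The integral of such a `G` over the Stiefel manifold is, up to a constant
independent of `G`, the Lebesgue integral of `G(X) χ(Xᵀ X)` for a cutoff function `χ`. By
homogeneity and Fubini over `GL(j)`, replacing `χ(Xᵀ X)` by `χ((A X)ᵀ (A X))` does not change the
Lebesgue integral. Hence the substitution `X ↦ A X` in it multiplies the integral over the Stiefel
manifold by `|det A| ^ (-j)`.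
-/

noncomputable section

open scoped Matrix ENNReal

section ConvexBodies

variable {U V W : Type*} [NormedAddCommGroup U] [NormedSpace ℝ U] [NormedAddCommGroup V]
  [NormedSpace ℝ V] [NormedAddCommGroup W] [NormedSpace ℝ W]

theorem coe_mapCLM (f : V →L[ℝ] W) (K : ConvexBody V) : (K.mapCLM f : Set W) = f '' (K : Set V) :=
  rfl

theorem mapCLM_mapCLM (f : V →L[ℝ] W) (g : U →L[ℝ] V) (K : ConvexBody U) :
    (K.mapCLM g).mapCLM f = K.mapCLM (f.comp g) :=
  SetLike.coe_injective (Set.image_image f g K)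

theorem mapCLM_sum {ι : Type*} (f : V →L[ℝ] W) (K : ι → ConvexBody V) (s : Finset ι) :
    (∑ i ∈ s, K i).mapCLM f = ∑ i ∈ s, (K i).mapCLM f := by
  classical
  induction s using Finset.induction_on with
  | empty =>
    apply SetLike.coe_injective
    simp [coe_mapCLM, ConvexBody.coe_zero, Set.singleton_zero]
  | insert a s ha ih =>
    rw [Finset.sum_insert ha, Finset.sum_insert ha, ← ih]
    apply SetLike.coe_injective
    simp [coe_mapCLM, Set.image_add]

end ConvexBodies

theorem mixedVolume_mapCLM {E F : Type*} [NormedAddCommGroup E] [InnerProductSpace ℝ E]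
    [FiniteDimensional ℝ E] [MeasurableSpace E] [BorelSpace E] [NormedAddCommGroup F]
    [InnerProductSpace ℝ F] [FiniteDimensional ℝ F] [MeasurableSpace F] [BorelSpace F] {j : ℕ}
    (f : E →L[ℝ] F) (c : ℝ)
    (hf : ∀ s : Set E, (volume : Measure F).real (f '' s) = c * (volume : Measure E).real s)
    (K : Fin j → ConvexBody E) :
    mixedVolume (fun i => (K i).mapCLM f) = c * mixedVolume K := by
  simp only [mixedVolume, ← mapCLM_sum, coe_mapCLM, hf, Finset.mul_sum]
  exact Finset.sum_congr rfl fun S _ => by ring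

theorem mixedVolume_mapCLM_linearIsometryEquiv {E F : Type*} [NormedAddCommGroup E]
    [InnerProductSpace ℝ E] [FiniteDimensional ℝ E] [MeasurableSpace E] [BorelSpace E]
    [NormedAddCommGroup F] [InnerProductSpace ℝ F] [FiniteDimensional ℝ F] [MeasurableSpace F]
    [BorelSpace F] {j : ℕ} (e : E ≃ₗᵢ[ℝ] F) (K : Fin j → ConvexBody E) :
    mixedVolume (fun i => (K i).mapCLM (e.toContinuousLinearEquiv : E →L[ℝ] F)) =
      mixedVolume K := by
  have hvol : ∀ s : Set E, volume.real (e '' s) = 1 * volume.real s := fun s => by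
    rw [one_mul, Measure.real, Measure.real, ← e.symm.measurePreserving.measure_preimage_emb
      e.symm.toHomeomorph.measurableEmbedding s]
    exact congrArg (fun t => (volume t).toReal) (e.toEquiv.image_eq_preimage_symm s)
  exact (mixedVolume_mapCLM _ 1 hvol K).trans (one_mul _)

section MatrixLebesgue

variable {ι κ : Type*}

instance : MeasurableSpace (Matrix ι κ ℝ) := inferInstanceAs (MeasurableSpace (ι → κ → ℝ))

instance [Countable ι] [Countable κ] : BorelSpace (Matrix ι κ ℝ) :=
  inferInstanceAs (BorelSpace (ι → κ → ℝ))

instance [Countable ι] [Countable κ] : PolishSpace (Matrix ι κ ℝ) :=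
  inferInstanceAs (PolishSpace (ι → κ → ℝ))

variable [Fintype ι] [Fintype κ]

instance : MeasureSpace (Matrix ι κ ℝ) := inferInstanceAs (MeasureSpace (ι → κ → ℝ))

instance : SigmaFinite (volume : Measure (Matrix ι κ ℝ)) :=
  inferInstanceAs (SigmaFinite (volume : Measure (ι → κ → ℝ)))

instance : IsFiniteMeasureOnCompacts (volume : Measure (Matrix ι κ ℝ)) :=
  inferInstanceAs (IsFiniteMeasureOnCompacts (volume : Measure (ι → κ → ℝ)))

instance : (volume : Measure (Matrix ι κ ℝ)).IsOpenPosMeasure :=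
  inferInstanceAs ((volume : Measure (ι → κ → ℝ)).IsOpenPosMeasure)

theorem lintegral_comp_linearMap {E : Type*} [NormedAddCommGroup E] [NormedSpace ℝ E]
    [MeasurableSpace E] [BorelSpace E] [FiniteDimensional ℝ E] (μ : Measure E)
    [μ.IsAddHaarMeasure] {f : E →ₗ[ℝ] E} (hf : LinearMap.det f ≠ 0) {F : E → ℝ≥0∞}
    (hF : Measurable F) :
    ∫⁻ x, F (f x) ∂μ = ‖(LinearMap.det f)⁻¹‖ₑ * ∫⁻ x, F x ∂μ := by
  rw [← lintegral_map hF f.continuous_of_finiteDimensional.measurable,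
    Measure.map_linearMap_addHaar_eq_smul_addHaar μ hf, lintegral_smul_measure,
    Real.enorm_eq_ofReal_abs, smul_eq_mul]

theorem det_mulRightLinearMap [DecidableEq κ] {R : Type*} [CommRing R] (T : Matrix κ κ R) :
    LinearMap.det (mulRightLinearMap ι R T) = T.det ^ Fintype.card ι := by
  have h : mulRightLinearMap ι R T =
      LinearMap.pi (φ := fun _ : ι => κ → R)
        fun i => (Matrix.toLin' Tᵀ).comp (LinearMap.proj i) := by
    ext1 X
    exact funext fun i => (Matrix.mul_apply_eq_vecMul X T i).trans
      (Matrix.mulVec_transpose T _).symm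
  rw [h]
  exact (LinearMap.det_pi _).trans (by simp)

theorem det_mulLeftLinearMap [DecidableEq ι] {R : Type*} [CommRing R] (A : Matrix ι ι R) :
    LinearMap.det (mulLeftLinearMap κ R A) = A.det ^ Fintype.card κ := by
  rw [← Matrix.det_transpose, ← det_mulRightLinearMap (ι := κ),
    ← LinearMap.det_conj _ (Matrix.transposeLinearEquiv κ ι R R)]
  congr 1
  ext1 X
  simp

theorem lintegral_matrix_comp_linearMap {L : Matrix ι κ ℝ →ₗ[ℝ] Matrix ι κ ℝ}
    (hL : LinearMap.det L ≠ 0) {F : Matrix ι κ ℝ → ℝ≥0∞} (hF : Measurable F) :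
    ∫⁻ X, F (L X) = ‖(LinearMap.det L)⁻¹‖ₑ * ∫⁻ X, F X :=
  lintegral_comp_linearMap (volume : Measure (ι → κ → ℝ)) hL hF

theorem lintegral_matrix_mul_right [DecidableEq κ] {F : Matrix ι κ ℝ → ℝ≥0∞} (hF : Measurable F)
    {T : Matrix κ κ ℝ} (hT : T.det ≠ 0) :
    ∫⁻ X : Matrix ι κ ℝ, F (X * T) = ‖T.det⁻¹‖ₑ ^ Fintype.card ι * ∫⁻ X, F X := by
  have hdet := det_mulRightLinearMap (ι := ι) T
  have h := lintegral_matrix_comp_linearMap (hdet ▸ pow_ne_zero _ hT) hF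
  rwa [hdet, ← inv_pow, enorm_pow] at h

theorem lintegral_matrix_mul_left [DecidableEq ι] {F : Matrix ι κ ℝ → ℝ≥0∞} (hF : Measurable F)
    {A : Matrix ι ι ℝ} (hA : A.det ≠ 0) :
    ∫⁻ X : Matrix ι κ ℝ, F (A * X) = ‖A.det⁻¹‖ₑ ^ Fintype.card κ * ∫⁻ X, F X := by
  have hdet := det_mulLeftLinearMap (κ := κ) A
  have h := lintegral_matrix_comp_linearMap (hdet ▸ pow_ne_zero _ hA) hF
  rwa [hdet, ← inv_pow, enorm_pow] at h

end MatrixLebesgue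

section MatrixMeasurability

variable {α ι κ l : Type*} [MeasurableSpace α]

@[fun_prop]
theorem measurable_matrix_mul [Countable ι] [Fintype κ] [Countable l] {f : α → Matrix ι κ ℝ}
    {g : α → Matrix κ l ℝ} (hf : Measurable f) (hg : Measurable g) :
    Measurable fun x => f x * g x :=
  (continuous_fst.matrix_mul continuous_snd).measurable.comp (hf.prodMk hg)

variable [Fintype κ] [DecidableEq κ]

@[fun_prop]
theorem measurable_matrix_det {f : α → Matrix κ κ ℝ} (hf : Measurable f) :
    Measurable fun x => (f x).det :=
  continuous_id.matrix_det.measurable.comp hf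

@[fun_prop]
theorem measurable_matrix_inv {f : α → Matrix κ κ ℝ} (hf : Measurable f) :
    Measurable fun x => (f x)⁻¹ := by
  simp only [Matrix.inv_def, Ring.inverse_eq_inv']
  have hadj : Measurable fun x => (f x).adjugate :=
    continuous_id.matrix_adjugate.measurable.comp hf
  exact measurable_pi_lambda _ fun i => measurable_pi_lambda _ fun k =>
    (measurable_matrix_det hf).inv.mul (measurable_pi_iff.mp (measurable_pi_iff.mp hadj i) k)

end MatrixMeasurability

section FrameDensities

variable {ι κ : Type*} [Fintype ι] [Fintype κ]

theorem gram_mul (X : Matrix ι κ ℝ) (T : Matrix κ κ ℝ) :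
    (X * T)ᵀ * (X * T) = Tᵀ * (Xᵀ * X) * T := by
  simp only [Matrix.transpose_mul, Matrix.mul_assoc]

variable [DecidableEq κ]

theorem enorm_inv_pow_ne_zero {d : ℝ} (hd : d ≠ 0) (p : ℕ) : ‖d⁻¹‖ₑ ^ p ≠ 0 :=
  pow_ne_zero p (enorm_ne_zero.mpr (inv_ne_zero hd))

/-- A density on the `κ`-frames in `ℝ^ι`: a function of a matrix (whose columns form the frame)
which is homogeneous of degree `-|ι|` under the right action of `GL(κ)`, so that integrating it
against a function is invariant under this action. -/
def IsFrameDensity (G : Matrix ι κ ℝ → ℝ≥0∞) : Prop :=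
  ∀ (X : Matrix ι κ ℝ) (T : Matrix κ κ ℝ), T.det ≠ 0 →
    G (X * T) = ‖T.det⁻¹‖ₑ ^ Fintype.card ι * G X

namespace IsFrameDensity

variable {G : Matrix ι κ ℝ → ℝ≥0∞}

theorem comp_mul_left (hG : IsFrameDensity G) (A : Matrix ι ι ℝ) :
    IsFrameDensity fun X : Matrix ι κ ℝ => G (A * X) := fun X T hT =>
  (congrArg G (Matrix.mul_assoc A X T).symm).trans (hG _ _ hT)

theorem lintegral_mul_comp_mul_right (hG : IsFrameDensity G) (hGm : Measurable G)
    {f : Matrix ι κ ℝ → ℝ≥0∞} (hf : Measurable f) {T : Matrix κ κ ℝ} (hT : T.det ≠ 0) :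
    ∫⁻ X, G X * f (X * T) = ∫⁻ X, G X * f X := by
  have htop : ‖T.det⁻¹‖ₑ ^ Fintype.card ι ≠ ⊤ := ENNReal.pow_ne_top enorm_ne_top
  have h := lintegral_matrix_mul_right (hGm.mul hf) hT
  simp only [Pi.mul_apply, hG _ _ hT, mul_assoc] at h
  rw [lintegral_const_mul' _ _ htop] at h
  exact (ENNReal.mul_right_inj (enorm_inv_pow_ne_zero hT _) htop).mp h

end IsFrameDensity

/-- The `p`-th inverse power of the `κ`-dimensional volume of the parallelepiped spanned by the
columns of `X`, which is `0` (not `∞`) at linearly dependent columns when `p ≠ 0`. -/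
def gramDensity (p : ℕ) (X : Matrix ι κ ℝ) : ℝ≥0∞ :=
  ‖(√(Xᵀ * X).det)⁻¹‖ₑ ^ p

theorem gramDensity_mul (p : ℕ) (X : Matrix ι κ ℝ) (T : Matrix κ κ ℝ) :
    gramDensity p (X * T) = ‖T.det⁻¹‖ₑ ^ p * gramDensity p X := by
  have h : √((X * T)ᵀ * (X * T)).det = |T.det| * √(Xᵀ * X).det := by
    rw [gram_mul, Matrix.det_mul, Matrix.det_mul, Matrix.det_transpose, mul_right_comm,
      Real.sqrt_mul (mul_self_nonneg _), Real.sqrt_mul_self_eq_abs]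
  rw [gramDensity, h, mul_inv, enorm_mul, mul_pow, ← abs_inv, Real.enorm_abs, gramDensity]

theorem gramDensity_square (p : ℕ) (T : Matrix κ κ ℝ) : gramDensity p T = ‖T.det⁻¹‖ₑ ^ p := by
  simpa [gramDensity] using gramDensity_mul p (1 : Matrix κ κ ℝ) T

theorem isFrameDensity_gramDensity :
    IsFrameDensity (gramDensity (Fintype.card ι) : Matrix ι κ ℝ → ℝ≥0∞) :=
  fun X T _ => gramDensity_mul _ X T

theorem measurable_gramDensity (p : ℕ) :
    Measurable (gramDensity p : Matrix ι κ ℝ → ℝ≥0∞) := by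
  unfold gramDensity
  fun_prop

variable (ι κ) in
/-- The measure on `κ`-frames in `ℝ^ι` that is invariant under `GL(κ)` and the orthogonal group.
For `ι = κ` it is a Haar measure of `GL(κ)`. -/
def frameMeasure : Measure (Matrix ι κ ℝ) :=
  volume.withDensity (gramDensity (Fintype.card ι))

instance : SFinite (frameMeasure ι κ) :=
  inferInstanceAs (SFinite (volume.withDensity _))

theorem lintegral_frameMeasure {f : Matrix ι κ ℝ → ℝ≥0∞} (hf : Measurable f) :
    ∫⁻ X, f X ∂frameMeasure ι κ = ∫⁻ X, gramDensity (Fintype.card ι) X * f X :=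
  lintegral_withDensity_eq_lintegral_mul _ (measurable_gramDensity _) hf

theorem lintegral_frameMeasure_mul_right {f : Matrix ι κ ℝ → ℝ≥0∞} (hf : Measurable f)
    {T : Matrix κ κ ℝ} (hT : T.det ≠ 0) :
    ∫⁻ X, f (X * T) ∂frameMeasure ι κ = ∫⁻ X, f X ∂frameMeasure ι κ := by
  rw [lintegral_frameMeasure hf, lintegral_frameMeasure (by fun_prop)]
  exact isFrameDensity_gramDensity.lintegral_mul_comp_mul_right (measurable_gramDensity _) hf hT

theorem lintegral_frameMeasure_mul_left {f : Matrix κ κ ℝ → ℝ≥0∞} (hf : Measurable f)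
    {S : Matrix κ κ ℝ} (hS : S.det ≠ 0) :
    ∫⁻ T, f (S * T) ∂frameMeasure κ κ = ∫⁻ T, f T ∂frameMeasure κ κ := by
  have htop : ‖S.det⁻¹‖ₑ ^ Fintype.card κ ≠ ⊤ := ENNReal.pow_ne_top enorm_ne_top
  have h := lintegral_matrix_mul_left ((measurable_gramDensity (Fintype.card κ)).mul hf) hS
  simp only [Pi.mul_apply, gramDensity_square, Matrix.det_mul, mul_inv, enorm_mul, mul_pow,
    mul_assoc] at h
  rw [lintegral_const_mul' _ _ htop] at h
  rw [lintegral_frameMeasure hf, lintegral_frameMeasure (by fun_prop)]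
  simp only [gramDensity_square]
  exact (ENNReal.mul_right_inj (enorm_inv_pow_ne_zero hS _) htop).mp h

theorem ae_frameMeasure_det_ne_zero : ∀ᵐ T ∂frameMeasure κ κ, T.det ≠ 0 := by
  rw [frameMeasure, ae_withDensity_iff (measurable_gramDensity _)]
  refine .of_forall fun T hT h => hT ?_
  have hκ : Fintype.card κ ≠ 0 := fun h0 => by
    have := Fintype.card_eq_zero_iff.mp h0
    simp at h
  rw [gramDensity_square, h, inv_zero, enorm_zero, zero_pow hκ]

end FrameDensities

section GramMatrices

variable {ι κ : Type*} [Fintype ι] [Fintype κ]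

theorem sq_le_trace_gram (X : Matrix ι κ ℝ) (i : ι) (k : κ) : X i k ^ 2 ≤ (Xᵀ * X).trace := by
  have htr : (Xᵀ * X).trace = ∑ k, ∑ i, X i k ^ 2 := by
    simp [Matrix.trace, Matrix.mul_apply, sq]
  rw [htr]
  exact (Finset.single_le_sum (f := fun i => X i k ^ 2) (fun _ _ => sq_nonneg _)
      (Finset.mem_univ i)).trans
    (Finset.single_le_sum (f := fun k => ∑ i, X i k ^ 2)
      (fun _ _ => Finset.sum_nonneg fun _ _ => sq_nonneg _) (Finset.mem_univ k))

variable [DecidableEq κ]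

open scoped MatrixOrder in
theorem exists_gram_eq_gram {X : Matrix ι κ ℝ} (hX : (Xᵀ * X).det ≠ 0) :
    ∃ S : Matrix κ κ ℝ, S.det ≠ 0 ∧ Xᵀ * X = Sᵀ * S := by
  have hpos : 0 ≤ Xᵀ * X :=
    Matrix.nonneg_iff_posSemidef.mpr (Matrix.posSemidef_conjTranspose_mul_self X)
  obtain ⟨S, hS⟩ := CStarAlgebra.nonneg_iff_eq_star_mul_self.mp hpos
  replace hS : Xᵀ * X = Sᵀ * S := hS
  refine ⟨S, fun h => hX ?_, hS⟩
  rw [hS, Matrix.det_mul, h, mul_zero]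

theorem det_gram_ne_zero_of_mul_left (A : Matrix ι ι ℝ) {X : Matrix ι κ ℝ}
    (h : ((A * X)ᵀ * (A * X)).det ≠ 0) : (Xᵀ * X).det ≠ 0 := by
  contrapose! h
  rw [← Matrix.exists_mulVec_eq_zero_iff] at h ⊢
  obtain ⟨v, hv, h⟩ := h
  have hX : X *ᵥ v = 0 := (Matrix.conjTranspose_mul_self_mulVec_eq_zero X v).mp h
  exact ⟨v, hv, by simp only [← Matrix.mulVec_mulVec, hX, Matrix.mulVec_zero]⟩

theorem det_gram_mul_left_ne_zero [DecidableEq ι] {A : Matrix ι ι ℝ} (hA : A.det ≠ 0)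
    {X : Matrix ι κ ℝ} (h : (Xᵀ * X).det ≠ 0) : ((A * X)ᵀ * (A * X)).det ≠ 0 := by
  have := Matrix.invertibleOfIsUnitDet A hA.isUnit
  exact det_gram_ne_zero_of_mul_left A⁻¹ (by rwa [Matrix.inv_mul_cancel_left_of_invertible])

variable {h : Matrix κ κ ℝ → ℝ≥0∞} (hh : Measurable h) {X : Matrix ι κ ℝ}
  (hX : (Xᵀ * X).det ≠ 0)

include hh hX

theorem lintegral_gram_mul :
    ∫⁻ T, h ((X * T)ᵀ * (X * T)) ∂frameMeasure κ κ = ∫⁻ T, h (Tᵀ * T) ∂frameMeasure κ κ := by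
  obtain ⟨S, hS, hXS⟩ := exists_gram_eq_gram hX
  have hgram : ∀ T, (X * T)ᵀ * (X * T) = (S * T)ᵀ * (S * T) := fun T => by
    rw [gram_mul, gram_mul, hXS]
  simp only [hgram]
  exact lintegral_frameMeasure_mul_left (f := fun T => h (Tᵀ * T)) (by fun_prop) hS

theorem lintegral_gram_mul_inv :
    ∫⁻ T, h ((X * T⁻¹)ᵀ * (X * T⁻¹)) ∂frameMeasure κ κ =
      ∫⁻ T, h ((T⁻¹)ᵀ * T⁻¹) ∂frameMeasure κ κ := by
  obtain ⟨S, hS, hXS⟩ := exists_gram_eq_gram hX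
  have := Matrix.invertibleOfIsUnitDet S hS.isUnit
  have hgram : ∀ T, (X * T⁻¹)ᵀ * (X * T⁻¹) = ((T * S⁻¹)⁻¹)ᵀ * (T * S⁻¹)⁻¹ := fun T => by
    rw [Matrix.mul_inv_rev, Matrix.inv_inv_of_invertible, gram_mul, gram_mul, hXS]
  simp only [hgram]
  exact lintegral_frameMeasure_mul_right (f := fun T => h ((T⁻¹)ᵀ * T⁻¹)) (by fun_prop)
    (Matrix.isUnit_nonsing_inv_det S hS.isUnit).ne_zero

end GramMatrices

section Averaging

variable {ι κ : Type*} [Fintype ι] [Fintype κ] [DecidableEq κ] {G : Matrix ι κ ℝ → ℝ≥0∞}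

theorem IsFrameDensity.lintegral_mul_lintegral_swap (hG : IsFrameDensity G) (hGm : Measurable G)
    {f g : Matrix ι κ ℝ → ℝ≥0∞} (hf : Measurable f) (hg : Measurable g) :
    ∫⁻ X, G X * f X * ∫⁻ T, g (X * T) ∂frameMeasure κ κ =
      ∫⁻ X, G X * g X * ∫⁻ T, f (X * T⁻¹) ∂frameMeasure κ κ := by
  have hT : ∀ T : Matrix κ κ ℝ, T.det ≠ 0 →
      ∫⁻ X, G X * f X * g (X * T) = ∫⁻ X, G X * g X * f (X * T⁻¹) := fun T hT => by
    have := Matrix.invertibleOfIsUnitDet T hT.isUnit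
    have h := hG.lintegral_mul_comp_mul_right hGm
      (f := fun Y => f (Y * T⁻¹) * g Y) (by fun_prop) hT
    simp only [Matrix.mul_inv_cancel_right_of_invertible] at h
    simp only [mul_assoc, h, mul_comm (g _)]
  calc ∫⁻ X, G X * f X * ∫⁻ T, g (X * T) ∂frameMeasure κ κ
      = ∫⁻ X, ∫⁻ T, G X * f X * g (X * T) ∂frameMeasure κ κ :=
        lintegral_congr fun X => (lintegral_const_mul _ (by fun_prop)).symm
    _ = ∫⁻ T, ∫⁻ X, G X * f X * g (X * T) ∂volume ∂frameMeasure κ κ :=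
        lintegral_lintegral_swap (by fun_prop)
    _ = ∫⁻ T, ∫⁻ X, G X * g X * f (X * T⁻¹) ∂volume ∂frameMeasure κ κ :=
        lintegral_congr_ae (ae_frameMeasure_det_ne_zero.mono hT)
    _ = ∫⁻ X, ∫⁻ T, G X * g X * f (X * T⁻¹) ∂frameMeasure κ κ :=
        (lintegral_lintegral_swap (by fun_prop)).symm
    _ = ∫⁻ X, G X * g X * ∫⁻ T, f (X * T⁻¹) ∂frameMeasure κ κ :=
        lintegral_congr fun X => lintegral_const_mul _ (by fun_prop)

theorem IsFrameDensity.lintegral_mul_gram_mul_left [DecidableEq ι] (hG : IsFrameDensity G)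
    (hGm : Measurable G) {h : Matrix κ κ ℝ → ℝ≥0∞} (hh : Measurable h)
    (h0 : ∀ P, P.det = 0 → h P = 0) {A : Matrix ι ι ℝ} (hA : A.det ≠ 0) :
    (∫⁻ T, h (Tᵀ * T) ∂frameMeasure κ κ) * ∫⁻ X, G X * h ((A * X)ᵀ * (A * X)) =
      (∫⁻ T, h ((T⁻¹)ᵀ * T⁻¹) ∂frameMeasure κ κ) * ∫⁻ X, G X * h (Xᵀ * X) := by
  rw [mul_comm, ← lintegral_mul_const _ (by fun_prop), mul_comm,
    ← lintegral_mul_const _ (by fun_prop)]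
  calc ∫⁻ X, G X * h ((A * X)ᵀ * (A * X)) * ∫⁻ T, h (Tᵀ * T) ∂frameMeasure κ κ
      = ∫⁻ X, G X * h ((A * X)ᵀ * (A * X)) *
          ∫⁻ T, h ((X * T)ᵀ * (X * T)) ∂frameMeasure κ κ :=
        lintegral_congr fun X => by
          by_cases hX : ((A * X)ᵀ * (A * X)).det = 0
          · simp only [h0 _ hX, mul_zero, zero_mul]
          · rw [lintegral_gram_mul hh (det_gram_ne_zero_of_mul_left A hX)]
    _ = ∫⁻ X, G X * h (Xᵀ * X) *
          ∫⁻ T, h ((A * (X * T⁻¹))ᵀ * (A * (X * T⁻¹))) ∂frameMeasure κ κ :=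
        hG.lintegral_mul_lintegral_swap hGm (f := fun X => h ((A * X)ᵀ * (A * X)))
          (g := fun X => h (Xᵀ * X)) (by fun_prop) (by fun_prop)
    _ = ∫⁻ X, G X * h (Xᵀ * X) * ∫⁻ T, h ((T⁻¹)ᵀ * T⁻¹) ∂frameMeasure κ κ :=
        lintegral_congr fun X => by
          by_cases hX : (Xᵀ * X).det = 0
          · simp only [h0 _ hX, mul_zero, zero_mul]
          · simp only [← lintegral_gram_mul_inv hh (det_gram_mul_left_ne_zero hA hX),
              Matrix.mul_assoc]

/-- The indicator of the Gram matrices of a bounded set of frames that is bounded away from the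
degenerate frames and is a neighbourhood of the orthonormal ones. -/
def gramCutoff (P : Matrix κ κ ℝ) : ℝ≥0∞ :=
  {P : Matrix κ κ ℝ | 1 / 2 < P.det ∧ P.trace < Fintype.card κ + 1}.indicator 1 P

theorem isOpen_support_gramCutoff :
    IsOpen {P : Matrix κ κ ℝ | 1 / 2 < P.det ∧ P.trace < Fintype.card κ + 1} :=
  (isOpen_lt continuous_const continuous_id.matrix_det).inter
    (isOpen_lt continuous_id.matrix_trace continuous_const)

theorem measurable_gramCutoff : Measurable (gramCutoff : Matrix κ κ ℝ → ℝ≥0∞) :=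
  measurable_one.indicator isOpen_support_gramCutoff.measurableSet

theorem measurable_gramCutoff_gram : Measurable fun X : Matrix ι κ ℝ => gramCutoff (Xᵀ * X) :=
  measurable_gramCutoff.comp (by fun_prop)

theorem gramCutoff_eq_zero_of_det_eq_zero {P : Matrix κ κ ℝ} (hP : P.det = 0) :
    gramCutoff P = 0 :=
  Set.indicator_of_notMem (fun h => by norm_num [hP] at h) _

theorem lintegral_gramCutoff_ne_zero {E : Matrix ι κ ℝ} (hE : Eᵀ * E = 1) :
    ∫⁻ X, gramCutoff (Xᵀ * X) ∂frameMeasure ι κ ≠ 0 := by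
  have hopen := isOpen_support_gramCutoff.preimage
    (f := fun X : Matrix ι κ ℝ => Xᵀ * X) (by fun_prop)
  rw [lintegral_frameMeasure measurable_gramCutoff_gram, ← pos_iff_ne_zero]
  refine (lintegral_pos_iff_support
    ((measurable_gramDensity _).mul measurable_gramCutoff_gram)).mpr ?_
  refine (hopen.measure_pos volume ⟨E, ?_⟩).trans_le (measure_mono fun X hX => ?_)
  · simp only [Set.mem_preimage, Set.mem_ofPred_eq, hE, Matrix.det_one, Matrix.trace_one]
    norm_num
  · have hdet : 0 < (Xᵀ * X).det := lt_trans (by norm_num) hX.1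
    have hχ : gramCutoff (Xᵀ * X) = 1 := Set.indicator_of_mem (Set.mem_preimage.mp hX) _
    rw [Function.mem_support, Pi.mul_apply, hχ, mul_one]
    exact enorm_inv_pow_ne_zero (Real.sqrt_pos.mpr hdet).ne' _

variable (ι κ) in
theorem lintegral_gramCutoff_ne_top : ∫⁻ X, gramCutoff (Xᵀ * X) ∂frameMeasure ι κ ≠ ⊤ := by
  let B : Set (Matrix ι κ ℝ) :=
    Set.univ.pi fun _ => Set.univ.pi fun _ => Metric.closedBall 0 (Fintype.card κ + 1)
  have hB : IsCompact B :=
    isCompact_univ_pi fun _ => isCompact_univ_pi fun _ => isCompact_closedBall _ _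
  have hle : ∀ X : Matrix ι κ ℝ, gramDensity (Fintype.card ι) X * gramCutoff (Xᵀ * X) ≤
      B.indicator (fun _ => 2 ^ Fintype.card ι) X := by
    intro X
    by_cases hX : gramCutoff (Xᵀ * X) = 0
    · simp [hX]
    have hmem := Set.mem_of_indicator_ne_zero hX
    have hχ : gramCutoff (Xᵀ * X) = 1 := Set.indicator_of_mem hmem _
    have hXB : X ∈ B := by
      intro i _ k _
      rw [mem_closedBall_zero_iff, Real.norm_eq_abs]
      refine abs_le_of_sq_le_sq ?_ (by positivity)
      nlinarith [sq_le_trace_gram X i k, hmem.2, Nat.cast_nonneg (α := ℝ) (Fintype.card κ)]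
    rw [Set.indicator_of_mem hXB, hχ, mul_one]
    refine pow_le_pow_left' ?_ _
    have hsqrt : 1 / 2 ≤ √(Xᵀ * X).det := Real.le_sqrt_of_sq_le (by linarith [hmem.1])
    rw [Real.enorm_of_nonneg (by positivity)]
    exact ENNReal.ofReal_le_of_le_toReal (by simpa using inv_anti₀ (by norm_num) hsqrt)
  rw [lintegral_frameMeasure measurable_gramCutoff_gram]
  refine ((lintegral_mono hle).trans_lt ?_).ne
  rw [lintegral_indicator_const hB.isClosed.measurableSet]
  exact ENNReal.mul_lt_top (by simp) hB.measure_lt_top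

end Averaging

section OrthogonalAveraging

variable {n j : ℕ}

theorem gram_orthogonal_mul {κ : Type*} (U : Matrix.orthogonalGroup (Fin n) ℝ)
    (X : Matrix (Fin n) κ ℝ) : (U.1 * X)ᵀ * (U.1 * X) = Xᵀ * X := by
  have hU : U.1ᵀ * U.1 = 1 := (Matrix.mem_orthogonalGroup_iff' (Fin n) ℝ).mp U.2
  rw [Matrix.transpose_mul, Matrix.mul_assoc, ← Matrix.mul_assoc U.1ᵀ, hU, Matrix.one_mul]

theorem enorm_det_orthogonal_inv (U : Matrix.orthogonalGroup (Fin n) ℝ) :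
    ‖U.1.det⁻¹‖ₑ = 1 := by
  have h : ‖U.1.det‖ = 1 := CStarRing.norm_of_mem_unitary (Matrix.det_of_mem_unitary U.2)
  rw [← ofReal_norm, norm_inv, h, inv_one, ENNReal.ofReal_one]

theorem gram_eq_one_iff {X : Matrix (Fin n) (Fin j) ℝ} : Xᵀ * X = 1 ↔ ∀ v w,
    inner ℝ (Matrix.toEuclideanLin X v) (Matrix.toEuclideanLin X w) = inner ℝ v w := by
  have h : ∀ v w, inner ℝ (Matrix.toEuclideanLin X v) (Matrix.toEuclideanLin X w) =
      inner ℝ (Matrix.toEuclideanLin (Xᵀ * X) v) w := fun v w => by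
    rw [← LinearMap.adjoint_inner_left, ← Matrix.toEuclideanLin_conjTranspose_eq_adjoint,
      Matrix.conjTranspose_eq_transpose_of_trivial, ← LinearMap.comp_apply,
      ← Matrix.toLpLin_mul_same]
  simp only [h]
  refine ⟨fun hX v w => by rw [hX, Matrix.toLpLin_one, LinearMap.id_apply], fun hX => ?_⟩
  refine Matrix.toEuclideanLin.injective (LinearMap.ext fun v => ext_inner_right ℝ fun w => ?_)
  rw [hX, Matrix.toLpLin_one, LinearMap.id_apply]

/-- A matrix with orthonormal columns, as an isometric embedding. -/
def frameIsometry {X : Matrix (Fin n) (Fin j) ℝ} (hX : Xᵀ * X = 1) :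
    EuclideanSpace ℝ (Fin j) →ₗᵢ[ℝ] EuclideanSpace ℝ (Fin n) :=
  (Matrix.toEuclideanLin X).isometryOfInner (gram_eq_one_iff.mp hX)

theorem exists_orthogonal_mul_eq {X Y : Matrix (Fin n) (Fin j) ℝ} (hX : Xᵀ * X = 1)
    (hY : Yᵀ * Y = 1) : ∃ U : Matrix.orthogonalGroup (Fin n) ℝ, U.1 * X = Y := by
  let T := Matrix.toEuclideanCLM (n := Fin n) (𝕜 := ℝ)
  let L := ((frameIsometry hY).comp (frameIsometry hX).equivRange.symm.toLinearIsometry).extend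
  have hL : ∀ v, L (frameIsometry hX v) = frameIsometry hY v := fun v => by
    have h := LinearIsometry.extend_apply
      ((frameIsometry hY).comp (frameIsometry hX).equivRange.symm.toLinearIsometry)
      ((frameIsometry hX).equivRange v)
    simpa using h
  have hmem : T.symm L.toContinuousLinearMap ∈ Matrix.orthogonalGroup (Fin n) ℝ := by
    have hstar : star L.toContinuousLinearMap * L.toContinuousLinearMap = 1 :=
      L.toContinuousLinearMap.isometry_iff_adjoint_comp_self.mp L.isometry
    refine (Matrix.mem_orthogonalGroup_iff' (Fin n) ℝ).mpr (EquivLike.injective T ?_)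
    rw [← Matrix.conjTranspose_eq_transpose_of_trivial, ← Matrix.star_eq_conjTranspose,
      map_mul, map_star, T.apply_symm_apply, hstar, map_one]
  refine ⟨⟨_, hmem⟩, ?_⟩
  refine Matrix.toEuclideanLin.injective (LinearMap.ext fun v => ?_)
  rw [Matrix.toLpLin_mul_same]
  exact (DFunLike.congr_fun (T.apply_symm_apply L.toContinuousLinearMap)
    (frameIsometry hX v)).trans (hL v)

theorem exists_eq_orthogonal_mul_mul {E X : Matrix (Fin n) (Fin j) ℝ} (hE : Eᵀ * E = 1)
    (hX : (Xᵀ * X).det ≠ 0) : ∃ (V : Matrix.orthogonalGroup (Fin n) ℝ)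
      (S : Matrix (Fin j) (Fin j) ℝ), S.det ≠ 0 ∧ X = V.1 * (E * S) := by
  obtain ⟨S, hS, hXS⟩ := exists_gram_eq_gram hX
  have := Matrix.invertibleOfIsUnitDet S hS.isUnit
  have hQ : (X * S⁻¹)ᵀ * (X * S⁻¹) = 1 := by
    rw [gram_mul, hXS, ← gram_mul, Matrix.mul_inv_of_invertible, Matrix.transpose_one,
      Matrix.mul_one]
  obtain ⟨V, hV⟩ := exists_orthogonal_mul_eq hE hQ
  exact ⟨V, S, hS, by rw [← Matrix.mul_assoc, hV, Matrix.inv_mul_cancel_right_of_invertible]⟩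

instance : IsProbabilityMeasure (orthogonalHaar n) := ⟨by
  simpa [orthogonalHaar] using Measure.haarMeasure_self
    (K₀ := (⊤ : TopologicalSpace.PositiveCompacts (Matrix.orthogonalGroup (Fin n) ℝ)))⟩

instance : (orthogonalHaar n).IsHaarMeasure :=
  inferInstanceAs (Measure.haarMeasure _).IsHaarMeasure

theorem lintegral_orthogonalHaar_mul_right {f : Matrix.orthogonalGroup (Fin n) ℝ → ℝ≥0∞}
    (hf : Measurable f) (V : Matrix.orthogonalGroup (Fin n) ℝ) :
    ∫⁻ U, f (U * V) ∂orthogonalHaar n = ∫⁻ U, f U ∂orthogonalHaar n := by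
  have hm : Measurable fun U : Matrix.orthogonalGroup (Fin n) ℝ => U * V :=
    (continuous_mul_const V).measurable
  have : IsProbabilityMeasure ((orthogonalHaar n).map (· * V)) :=
    Measure.isProbabilityMeasure_map hm.aemeasurable
  have h : (orthogonalHaar n).map (· * V) = orthogonalHaar n :=
    Measure.isHaarMeasure_eq_of_isProbabilityMeasure _ _
  rw [← lintegral_map hf hm, h]

namespace IsFrameDensity

variable {G : Matrix (Fin n) (Fin j) ℝ → ℝ≥0∞} (hG : IsFrameDensity G) (hGm : Measurable G)
  {E : Matrix (Fin n) (Fin j) ℝ} (hE : Eᵀ * E = 1)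

include hG hGm hE

theorem lintegral_orthogonal_mul {X : Matrix (Fin n) (Fin j) ℝ} (hX : (Xᵀ * X).det ≠ 0) :
    ∫⁻ U, G (U.1 * X) ∂orthogonalHaar n =
      gramDensity (Fintype.card (Fin n)) X * ∫⁻ U, G (U.1 * E) ∂orthogonalHaar n := by
  obtain ⟨V, S, hS, rfl⟩ := exists_eq_orthogonal_mul_mul hE hX
  have hdens : gramDensity (Fintype.card (Fin n)) (V.1 * (E * S)) =
      ‖S.det⁻¹‖ₑ ^ Fintype.card (Fin n) := by
    rw [← gramDensity_square, gramDensity, gram_orthogonal_mul, gram_mul, hE, Matrix.mul_one,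
      gramDensity]
  have hUX : ∀ U : Matrix.orthogonalGroup (Fin n) ℝ,
      G (U.1 * (V.1 * (E * S))) = ‖S.det⁻¹‖ₑ ^ Fintype.card (Fin n) * G ((U * V).1 * E) :=
    fun U => by
      rw [← hG _ _ hS]
      simp only [Submonoid.coe_mul, Matrix.mul_assoc]
  simp only [hUX]
  rw [lintegral_const_mul' _ _ (ENNReal.pow_ne_top enorm_ne_top), hdens,
    lintegral_orthogonalHaar_mul_right (f := fun U => G (U.1 * E)) (by fun_prop)]

theorem lintegral_mul_gram {h : Matrix (Fin j) (Fin j) ℝ → ℝ≥0∞} (hh : Measurable h)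
    (h0 : ∀ P, P.det = 0 → h P = 0) :
    ∫⁻ X, G X * h (Xᵀ * X) = (∫⁻ U, G (U.1 * E) ∂orthogonalHaar n) *
      ∫⁻ X, h (Xᵀ * X) ∂frameMeasure (Fin n) (Fin j) := by
  have hU : ∀ U : Matrix.orthogonalGroup (Fin n) ℝ,
      ∫⁻ X : Matrix (Fin n) (Fin j) ℝ, G (U.1 * X) * h (Xᵀ * X) =
        ∫⁻ X, G X * h (Xᵀ * X) := fun U => by
    have hdet : U.1.det ≠ 0 := fun h => by simpa [h] using enorm_det_orthogonal_inv U
    have := lintegral_matrix_mul_left (F := fun X => G X * h (Xᵀ * X)) (by fun_prop) hdet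
    simpa only [gram_orthogonal_mul, enorm_det_orthogonal_inv, one_pow, one_mul] using this
  calc ∫⁻ X, G X * h (Xᵀ * X)
      = ∫⁻ U : Matrix.orthogonalGroup (Fin n) ℝ,
          ∫⁻ X : Matrix (Fin n) (Fin j) ℝ, G (U.1 * X) * h (Xᵀ * X) ∂volume ∂orthogonalHaar n := by
        simp only [hU, lintegral_const, measure_univ, mul_one]
    _ = ∫⁻ X, ∫⁻ U, G (U.1 * X) * h (Xᵀ * X) ∂orthogonalHaar n :=
        lintegral_lintegral_swap (by fun_prop)
    _ = ∫⁻ X, (∫⁻ U, G (U.1 * E) ∂orthogonalHaar n) *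
          (gramDensity (Fintype.card (Fin n)) X * h (Xᵀ * X)) :=
        lintegral_congr fun X => by
          by_cases hX : (Xᵀ * X).det = 0
          · simp only [h0 _ hX, mul_zero, lintegral_zero]
          · rw [lintegral_mul_const _ (by fun_prop), hG.lintegral_orthogonal_mul hGm hE hX]
            ring
    _ = (∫⁻ U, G (U.1 * E) ∂orthogonalHaar n) *
          ∫⁻ X, h (Xᵀ * X) ∂frameMeasure (Fin n) (Fin j) := by
        have hm : Measurable fun X : Matrix (Fin n) (Fin j) ℝ =>
            gramDensity (Fintype.card (Fin n)) X * h (Xᵀ * X) :=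
          (measurable_gramDensity _).mul (by fun_prop)
        rw [lintegral_const_mul _ hm, lintegral_frameMeasure (by fun_prop)]

theorem lintegral_mul_orthogonal_mul {A : Matrix (Fin n) (Fin n) ℝ} (hA : A.det ≠ 0) :
    ∫⁻ U, G (A * (U.1 * E)) ∂orthogonalHaar n =
      ‖A.det⁻¹‖ₑ ^ j * ∫⁻ U, G (U.1 * E) ∂orthogonalHaar n := by
  have h0 : ∀ P : Matrix (Fin j) (Fin j) ℝ, P.det = 0 → gramCutoff P = 0 :=
    fun _ => gramCutoff_eq_zero_of_det_eq_zero
  have hGA : Measurable fun X : Matrix (Fin n) (Fin j) ℝ => G (A * X) := by fun_prop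
  set m := ∫⁻ T, gramCutoff (Tᵀ * T) ∂frameMeasure (Fin j) (Fin j)
  set M := ∫⁻ X, gramCutoff (Xᵀ * X) ∂frameMeasure (Fin n) (Fin j)
  have hm0 : m ≠ 0 := lintegral_gramCutoff_ne_zero (E := 1) (by simp)
  have hm : m ≠ ⊤ := lintegral_gramCutoff_ne_top _ _
  have hM0 : M ≠ 0 := lintegral_gramCutoff_ne_zero hE
  have hM : M ≠ ⊤ := lintegral_gramCutoff_ne_top _ _
  -- Both cutoffs `χ(XᵀX)` and `χ((AX)ᵀAX)` yield the same integral of the density `X ↦ G (A X)`.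
  have hcutoff : m * ∫⁻ X : Matrix (Fin n) (Fin j) ℝ, G (A * X) * gramCutoff (Xᵀ * X) =
      m * ∫⁻ X : Matrix (Fin n) (Fin j) ℝ, G (A * X) * gramCutoff ((A * X)ᵀ * (A * X)) := by
    rw [(hG.comp_mul_left A).lintegral_mul_gram_mul_left hGA measurable_gramCutoff h0 hA]
    simpa only [Matrix.one_mul] using (hG.comp_mul_left A).lintegral_mul_gram_mul_left hGA
      measurable_gramCutoff h0 (A := 1) (by simp)
  have hchange : ∫⁻ X : Matrix (Fin n) (Fin j) ℝ, G (A * X) * gramCutoff ((A * X)ᵀ * (A * X)) =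
      ‖A.det⁻¹‖ₑ ^ j * ∫⁻ X, G X * gramCutoff (Xᵀ * X) := by
    simpa only [Fintype.card_fin, Pi.mul_apply] using
      lintegral_matrix_mul_left (hGm.mul measurable_gramCutoff_gram) hA
  rw [← ENNReal.mul_left_inj hM0 hM, ← ENNReal.mul_right_inj hm0 hm, mul_assoc (_ ^ j),
    ← (hG.comp_mul_left A).lintegral_mul_gram hGA hE measurable_gramCutoff h0,
    ← hG.lintegral_mul_gram hGm hE measurable_gramCutoff h0, hcutoff, hchange]

end IsFrameDensity

end OrthogonalAveraging

section FrameVolume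

variable {n j : ℕ}

/-- The linear map `x ↦ Xᵀ x`, whose coordinates are the inner products with the columns of `X`.
If these are an orthonormal basis of `ξ`, it is the orthogonal projection onto `ξ` followed by an
isometry. -/
def frameMap (X : Matrix (Fin n) (Fin j) ℝ) :
    EuclideanSpace ℝ (Fin n) →L[ℝ] EuclideanSpace ℝ (Fin j) :=
  (Matrix.toEuclideanLin Xᵀ).toContinuousLinearMap

theorem frameMap_apply (X : Matrix (Fin n) (Fin j) ℝ) (x : EuclideanSpace ℝ (Fin n)) :
    frameMap X x = WithLp.toLp 2 (Xᵀ *ᵥ x.ofLp) :=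
  rfl

theorem inner_frameMap (X : Matrix (Fin n) (Fin j) ℝ) (x : EuclideanSpace ℝ (Fin n))
    (v : EuclideanSpace ℝ (Fin j)) :
    inner ℝ (frameMap X x) v = inner ℝ x (Matrix.toEuclideanLin X v) := by
  rw [← LinearMap.adjoint_inner_left, ← Matrix.toEuclideanLin_conjTranspose_eq_adjoint]
  rfl

/-- The mixed volume in `ℝ^j` of the images of the bodies under `Xᵀ`. -/
def frameVolume (K : Fin j → ConvexBody (EuclideanSpace ℝ (Fin n)))
    (X : Matrix (Fin n) (Fin j) ℝ) : ℝ :=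
  mixedVolume fun i => (K i).mapCLM (frameMap X)

variable (K : Fin j → ConvexBody (EuclideanSpace ℝ (Fin n)))

theorem frameVolume_mul (X : Matrix (Fin n) (Fin j) ℝ) (T : Matrix (Fin j) (Fin j) ℝ) :
    frameVolume K (X * T) = |T.det| * frameVolume K X := by
  have hcomp : frameMap (X * T) = (frameMap T).comp (frameMap X) := by
    ext x k
    simp [frameMap_apply, Matrix.transpose_mul]
  have hvol : ∀ s : Set (EuclideanSpace ℝ (Fin j)),
      volume.real (frameMap T '' s) = |T.det| * volume.real s := fun s => by
    have h := Measure.addHaar_image_linearMap volume (Matrix.toEuclideanLin Tᵀ) s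
    rw [LinearMap.det_toLpLin, Matrix.det_transpose] at h
    exact (congrArg ENNReal.toReal h).trans (by simp [Measure.real])
  rw [frameVolume, hcomp]
  simp only [← mapCLM_mapCLM]
  exact mixedVolume_mapCLM _ _ hvol _

theorem frameVolume_mapCLM (A : Matrix (Fin n) (Fin n) ℝ) (X : Matrix (Fin n) (Fin j) ℝ) :
    frameVolume (fun i => (K i).mapCLM (Matrix.toEuclideanCLM (n := Fin n) (𝕜 := ℝ) A)) X =
      frameVolume K (Aᵀ * X) := by
  have hcomp : frameMap (Aᵀ * X) =
      (frameMap X).comp (Matrix.toEuclideanCLM (n := Fin n) (𝕜 := ℝ) A) := by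
    ext x k
    simp [frameMap_apply, Matrix.transpose_mul]
  simp only [frameVolume, mapCLM_mapCLM, hcomp]

theorem isClosed_setOf_mem_frameMap_image {s : Set (EuclideanSpace ℝ (Fin n))}
    (hs : IsCompact s) :
    IsClosed {p : Matrix (Fin n) (Fin j) ℝ × EuclideanSpace ℝ (Fin j) |
      p.2 ∈ frameMap p.1 '' s} := by
  have : CompactSpace s := isCompact_iff_compactSpace.mp hs
  have hcont : Continuous fun q : (Matrix (Fin n) (Fin j) ℝ × EuclideanSpace ℝ (Fin j)) × s =>
      frameMap q.1.1 q.2 := by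
    simp only [frameMap_apply]
    fun_prop
  convert isClosedMap_fst_of_compactSpace _ (isClosed_eq hcont continuous_fst.snd) using 1
  ext p
  simp

theorem measurable_frameVolume : Measurable (frameVolume K) := by
  unfold frameVolume mixedVolume
  simp only [← mapCLM_sum, coe_mapCLM]
  refine measurable_const.mul (Finset.measurable_sum _ fun S _ => measurable_const.mul ?_)
  exact (measurable_measure_prodMk_left (isClosed_setOf_mem_frameMap_image
    (ConvexBody.isCompact _)).measurableSet).ennreal_toReal

end FrameVolume

section Grassmannian

variable {n j : ℕ}

/-- The columns of `X` form an orthonormal basis of the subspace `ξ`. -/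
structure IsOrthonormalFrame (X : Matrix (Fin n) (Fin j) ℝ) (ξ : RealGrassmannian n j) :
    Prop where
  gram_eq_one : Xᵀ * X = 1
  range_eq : (Matrix.toEuclideanLin X).range = ξ.toSubmodule

theorem exists_isOrthonormalFrame (ξ : RealGrassmannian n j) :
    ∃ X : Matrix (Fin n) (Fin j) ℝ, IsOrthonormalFrame X ξ := by
  let b := (stdOrthonormalBasis ℝ ξ.1).reindex (finCongr ξ.2)
  let f := ξ.1.subtypeₗᵢ.comp b.repr.symm.toLinearIsometry
  have hX : Matrix.toEuclideanLin (Matrix.toEuclideanLin.symm f.toLinearMap) = f.toLinearMap :=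
    Matrix.toEuclideanLin.apply_symm_apply _
  refine ⟨Matrix.toEuclideanLin.symm f.toLinearMap, gram_eq_one_iff.mpr ?_, ?_⟩
  · rw [hX]
    exact f.inner_map_map
  · rw [hX]
    exact (LinearMap.range_comp_of_range_eq_top _
      (LinearMap.range_eq_top.mpr b.repr.symm.surjective)).trans ξ.1.range_subtype

namespace IsOrthonormalFrame

variable {X Y : Matrix (Fin n) (Fin j) ℝ} {ξ η : RealGrassmannian n j}

theorem rotate (hX : IsOrthonormalFrame X ξ) (U : Matrix.orthogonalGroup (Fin n) ℝ) :
    IsOrthonormalFrame (U.1 * X) (RealGrassmannian.rotate U ξ) where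
  gram_eq_one := (gram_orthogonal_mul U X).trans hX.gram_eq_one
  range_eq := by
    rw [Matrix.toLpLin_mul_same, LinearMap.range_comp, hX.range_eq]
    rfl

theorem eq (hξ : IsOrthonormalFrame X ξ) (hη : IsOrthonormalFrame X η) : ξ = η := by
  cases ξ
  cases η
  simpa using hξ.range_eq.symm.trans hη.range_eq

/-- The coordinates with respect to an orthonormal frame of `ξ`. -/
def coordEquiv (hX : IsOrthonormalFrame X ξ) :
    ξ.toSubmodule ≃ₗᵢ[ℝ] EuclideanSpace ℝ (Fin j) :=
  ((frameIsometry hX.gram_eq_one).equivRange.trans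
    (LinearIsometryEquiv.ofEq _ _ hX.range_eq)).symm

theorem coe_coordEquiv_symm (hX : IsOrthonormalFrame X ξ) (v : EuclideanSpace ℝ (Fin j)) :
    (hX.coordEquiv.symm v : EuclideanSpace ℝ (Fin n)) = Matrix.toEuclideanLin X v :=
  rfl

theorem frameMap_eq (hX : IsOrthonormalFrame X ξ) :
    frameMap X = (hX.coordEquiv.toContinuousLinearEquiv :
      ξ.toSubmodule →L[ℝ] EuclideanSpace ℝ (Fin j)).comp
        ξ.toSubmodule.orthogonalProjectionOnto := by
  ext1 x
  refine ext_inner_right ℝ fun v => ?_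
  rw [inner_frameMap, ← hX.coe_coordEquiv_symm,
    ← Submodule.inner_orthogonalProjectionOnto_eq_of_mem_right,
    ← hX.coordEquiv.inner_map_map, hX.coordEquiv.apply_symm_apply]
  rfl

theorem mixedProjectionVolume_eq (hX : IsOrthonormalFrame X ξ)
    (K : Fin j → ConvexBody (EuclideanSpace ℝ (Fin n))) :
    mixedProjectionVolume K ξ = frameVolume K X := by
  rw [frameVolume, hX.frameMap_eq]
  simp only [← mapCLM_mapCLM]
  exact (mixedVolume_mapCLM_linearIsometryEquiv _ _).symm

end IsOrthonormalFrame

namespace RealGrassmannian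

theorem rotate_surjective (ξ : RealGrassmannian n j) :
    Function.Surjective fun U : Matrix.orthogonalGroup (Fin n) ℝ => rotate U ξ := fun η => by
  obtain ⟨X, hX⟩ := exists_isOrthonormalFrame ξ
  obtain ⟨Y, hY⟩ := exists_isOrthonormalFrame η
  obtain ⟨U, rfl⟩ := exists_orthogonal_mul_eq hX.gram_eq_one hY.gram_eq_one
  exact ⟨U, (hX.rotate U).eq hY⟩

instance : SecondCountableTopology (RealGrassmannian n j) :=
  TopologicalSpace.secondCountableTopology_induced _ _ _

instance : T0Space (RealGrassmannian n j) := by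
  have hind : Topology.IsInducing fun ξ : RealGrassmannian n j => ξ.1.starProjection := ⟨rfl⟩
  refine (Topology.IsEmbedding.mk hind fun ξ η h => ?_).t0Space
  cases ξ
  cases η
  simpa using Submodule.starProjection_inj.mp h

end RealGrassmannian

instance : PolishSpace (Matrix.orthogonalGroup (Fin n) ℝ) := by
  have h : CompactSpace (Matrix.orthogonalGroup (Fin n) ℝ) := inferInstance
  exact (isCompact_iff_compactSpace.mpr h).isClosed.polishSpace

variable (K : Fin j → ConvexBody (EuclideanSpace ℝ (Fin n)))

-- The map `U ↦ U ξ` is a continuous surjection of a Polish space onto the Grassmannian, and such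
-- a map detects Borel measurability, so no measurable choice of frames is needed.
theorem measurable_mixedProjectionVolume :
    Measurable (mixedProjectionVolume K : RealGrassmannian n j → ℝ) := by
  obtain _ | ⟨⟨ξ⟩⟩ := isEmpty_or_nonempty (RealGrassmannian n j)
  · exact measurable_of_empty _
  obtain ⟨X, hX⟩ := exists_isOrthonormalFrame ξ
  rw [← (RealGrassmannian.continuous_rotate ξ).measurable.measurable_comp_iff_of_surjective
    (RealGrassmannian.rotate_surjective ξ)]
  have h : mixedProjectionVolume K ∘ (fun U => RealGrassmannian.rotate U ξ) =
      fun U => frameVolume K (U.1 * X) :=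
    funext fun U => (hX.rotate U).mixedProjectionVolume_eq K
  rw [h]
  exact (measurable_frameVolume K).comp (by fun_prop)

theorem IsOrthonormalFrame.lintegral_haar {hj : j ≤ n} {E : Matrix (Fin n) (Fin j) ℝ}
    (hE : IsOrthonormalFrame E (RealGrassmannian.coordinate hj)) {f : ℝ → ℝ≥0∞}
    (hf : Measurable f) :
    ∫⁻ ξ, f (mixedProjectionVolume K ξ) ∂(RealGrassmannian.haar hj) =
      ∫⁻ U, f (frameVolume K (U.1 * E)) ∂orthogonalHaar n := by
  refine (lintegral_map (hf.comp (measurable_mixedProjectionVolume K))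
    (RealGrassmannian.continuous_rotate _).measurable).trans ?_
  simp only [Function.comp_apply, (hE.rotate _).mixedProjectionVolume_eq K]

end Grassmannian

section Quermassintegral

variable {n j : ℕ} (K : Fin j → ConvexBody (EuclideanSpace ℝ (Fin n)))

theorem isFrameDensity_frameVolume :
    IsFrameDensity fun X : Matrix (Fin n) (Fin j) ℝ =>
      (ENNReal.ofReal (frameVolume K X) / unitBallVolume j) ^ (-(n : ℝ)) := fun X T hT => by
  have hT0 : ‖T.det‖ₑ ≠ 0 := enorm_ne_zero.mpr hT
  simp only
  rw [frameVolume_mul, ENNReal.ofReal_mul (abs_nonneg _), ← Real.enorm_eq_ofReal_abs,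
    mul_div_assoc, ENNReal.mul_rpow_eq_ite, if_neg (by simp [hT0]), ENNReal.rpow_neg,
    ENNReal.rpow_natCast, ENNReal.inv_pow, ← enorm_inv hT, Fintype.card_fin]

theorem lemma2p1_general (hj : j ≤ n) {A : Matrix (Fin n) (Fin n) ℝ} (hA : A.det ≠ 0) :
    mixedAffineQuermassintegral hj
        (fun i => (K i).mapCLM (Matrix.toEuclideanCLM (n := Fin n) (𝕜 := ℝ) A)) =
      ‖A.det‖ₑ ^ ((j : ℝ) / n) * mixedAffineQuermassintegral hj K := by
  obtain ⟨E, hE⟩ := exists_isOrthonormalFrame (RealGrassmannian.coordinate hj)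
  have hf : Measurable fun v : ℝ => (ENNReal.ofReal v / unitBallVolume j) ^ (-(n : ℝ)) :=
    (ENNReal.measurable_ofReal.div_const _).pow_const _
  have hdet : Aᵀ.det ≠ 0 := A.det_transpose ▸ hA
  have havg := (isFrameDensity_frameVolume K).lintegral_mul_orthogonal_mul
    (hf.comp (measurable_frameVolume K)) hE.gram_eq_one hdet
  have hpow : (‖A.det⁻¹‖ₑ ^ j) ^ (-(1 / (n : ℝ))) = ‖A.det‖ₑ ^ ((j : ℝ) / n) := by
    rw [enorm_inv hA, ← ENNReal.rpow_natCast, ← ENNReal.rpow_mul, ENNReal.inv_rpow,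
      ← ENNReal.rpow_neg]
    congr 1
    ring
  unfold mixedAffineQuermassintegral
  rw [hE.lintegral_haar _ hf, hE.lintegral_haar _ hf]
  simp only [frameVolume_mapCLM]
  have h0 : ‖A.det⁻¹‖ₑ ^ j ≠ 0 := enorm_inv_pow_ne_zero hA j
  have htop : ‖A.det⁻¹‖ₑ ^ j ≠ ⊤ := ENNReal.pow_ne_top enorm_ne_top
  rw [havg, Matrix.det_transpose, ENNReal.mul_rpow_eq_ite, if_neg (by simp only [h0, htop,
    false_and, or_self, not_false_eq_true]), hpow, mul_left_comm]

end Quermassintegral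

end

theorem lemma2p1 {n j : ℕ} (hj : j ≤ n)
    (K : Fin j → ConvexBody (EuclideanSpace ℝ (Fin n)))
    (g : Matrix.SpecialLinearGroup (Fin n) ℝ) :
    mixedAffineQuermassintegral hj (fun i => (K i).slImage g) =
      mixedAffineQuermassintegral hj K := by
  simpa [g.2, ConvexBody.slImage] using lemma2p1_general K hj (A := g.1) (by simp [g.2])
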